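/- Let $K$ be a finite simplicial complex, i.e. a finite collection of non-empty finite sets such that every non-empty subset of a member is a member (the case $K=\emptyset$ is allowed). For $p\in\mathbb Z$ let $K^{(p)}$ be the set of faces with $p+1$ elements and let $K[p]$ be the $\mathbb Z/2$-vector space of subsets of $K^{(p)}$ (with symmetric difference as addition). Let $\partial_p:K[p]\to K[p-1]$ and $\delta_p:K[p]\to K[p+1]$ be the linear boundary and coboundary operators: for $\nu\in K^{(p)}$, $\partial(\nu)=\{\mu\in K^{(p-1)}:\mu\subset\nu\}$ and $\delta(\nu)=\{\mu\in K^{(p+1)}:\nu\subset\mu\}$. A Morse sequence on $K$ is a sequence $\overrightarrow W=\langle\emptyset=K_0,\dots,K_k=K\rangle$ of simplicial complexes such that, for each $i\in[1,k]$, either $K_{i-1}=K_i\setminus\{\nu\}$ where $\nu$ is a face of $K_i$ maximal for inclusion (then $\nu$ is called critical), or $K_{i-1}=K_i\setminus\{\sigma,\tau\}$ where $\tau$ is the only face of $K_i$ properly containing the face $\sigma$ of $K_i$ (then $(\sigma,\tau)$ is called a regular pair, $\sigma$ lower regular and $\tau$ upper regular). Let $\widehat W$ be the set of critical faces and $\widehat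 W[p]=\{c\in K[p]:c\subseteq\widehat W\}$. The reference map $\curlywedge$ and the coreference map $\curlyvee$ of $\overrightarrow W$ are the unique families of linear maps $\curlywedge_p,\curlyvee_p:K[p]\to\widehat W[p]$ such that $\curlywedge(\nu)=\curlyvee(\nu)=\nu$ for each critical $\nu$; $\curlywedge(\tau)=0$ and $\curlywedge(\partial(\tau))=0$ for each upper regular $\tau$; and $\curlyvee(\sigma)=0$ and $\curlyvee(\delta(\sigma))=0$ for each lower regular $\sigma$. The extension and coextension maps $\widetilde{\curlywedge}_p,\widetilde{\curlyvee}_p:\widehat W[p]\to K[p]$ are the linear maps given on critical faces $\kappa\in K^{(p)}$ by $$\widetilde{\curlywedge}(\kappa)=\{\nu\in K^{(p)}:\kappa\in\curlyvee(\nu)\},\qquad \widetilde{\curlyvee}(\kappa)=\{\nu\in K^{(p)}:\kappa\in\curlywedge(\nu)\}.$$ Let $V_p:K[p]\to K[p+1]$ and $V^*_p:K[p]\to K[p-1]$ be the linear maps that vanish on critical faces and satisfy $V(\sigma)=\tau$, $V(\tau)=0$, $V^*(\sigma)=0$, $V^*(\tau)=\sigma$ for each regular pair $(\sigma,\tau)$.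 The gradient flow and coflow are the linear maps $K[p]\to K[p]$ $$\Phi_p=\mathrm{id}+\partial_{p+1}V_p+V_{p-1}\partial_p,\qquad \Phi^*_p=\mathrm{id}+\delta_{p-1}V^*_p+V^*_{p+1}\delta_p .$$ Theorem. For every Morse sequence $\overrightarrow W$ on $K$, every $p\in\mathbb Z$ and every $c\in K[p]$, there are integers $i,j\ge 0$ with $\Phi^{i+1}(c)=\Phi^i(c)$ and $(\Phi^*)^{j+1}(c)=(\Phi^*)^j(c)$. Writing $\overline\Phi_p(c)=\Phi^i(c)$ and $\underline\Phi_p(c)=(\Phi^*)^j(c)$ for these stable values (which do not depend on the choice of $i$ and $j$), we have $$\overline\Phi_p=\widetilde{\curlywedge}_p\circ\curlywedge_p\qquad\text{and}\qquad\underline\Phi_p=\widetilde{\curlyvee}_p\circ\curlyvee_p .$$ -/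

import Mathlib

set_option linter.unusedSectionVars false

noncomputable section

namespace PreAbstractSimplicialComplex

variable {α : Type*}

/-! Collapses, expansions, perforations and fillings. -/

/-- `ν` is a facet of `K`: a face that is maximal for inclusion. -/
def IsFacet (K : PreAbstractSimplicialComplex α) (ν : Finset α) : Prop :=
  ν ∈ K ∧ ∀ ρ ∈ K, ν ⊆ ρ → ρ = ν

/-- `(σ, τ)` is a free pair for `K`: `τ` is the only face of `K` that properly contains the
face `σ`. -/
def IsFreePair (K : PreAbstractSimplicialComplex α) (σ τ : Finset α) : Prop :=
  σ ∈ K ∧ τ ∈ K ∧ ∀ ρ ∈ K, σ ⊂ ρ ↔ ρ = τ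

/-- `K` is the elementary expansion of `L` by the free pair `(σ, τ)` of `K`:
`L = K \ {σ, τ}`. -/
def IsExpansionBy (L K : PreAbstractSimplicialComplex α) (σ τ : Finset α) : Prop :=
  K.IsFreePair σ τ ∧ L.faces = K.faces \ {σ, τ}

/-- `K` is the elementary filling of `L` by the facet `ν` of `K`: `L = K \ {ν}`. -/
def IsFillingBy (L K : PreAbstractSimplicialComplex α) (ν : Finset α) : Prop :=
  K.IsFacet ν ∧ L.faces = K.faces \ {ν}

def IsElementaryExpansion (L K : PreAbstractSimplicialComplex α) : Prop :=
  ∃ σ τ, IsExpansionBy L K σ τ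

def IsElementaryFilling (L K : PreAbstractSimplicialComplex α) : Prop :=
  ∃ ν, IsFillingBy L K ν

/-! Chains modulo 2. -/

/-- The type of `p`-simplices of `K`, that is, the faces with `p + 1` elements (`p ∈ ℤ`). -/
abbrev Simplex (K : PreAbstractSimplicialComplex α) (p : ℤ) : Type _ :=
  {σ : Finset α // σ ∈ K ∧ (σ.card : ℤ) - 1 = p}

/-- The `p`-chains of `K`. A chain is identified with a set of `p`-simplices, its support; the
addition is then the symmetric difference. -/
abbrev Chain (K : PreAbstractSimplicialComplex α) (p : ℤ) : Type _ :=
  K.Simplex p →₀ ZMod 2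

instance (K : PreAbstractSimplicialComplex α) [Finite K] (p : ℤ) : Finite (K.Simplex p) :=
  Finite.of_injective (fun σ => (⟨σ.1, σ.2.1⟩ : K)) (fun _ _ h =>
    Subtype.ext (congrArg (fun x : K => (x : Finset α)) h))

section Chains

variable (K : PreAbstractSimplicialComplex α) [Finite K]

variable {K} in
/-- The chain whose elements are the elements of the set `S`. -/
def chainOf {p : ℤ} (S : Set (K.Simplex p)) : K.Chain p :=
  Finsupp.equivFunOnFinite.symm (S.indicator 1)

/-- The boundary operator from `p`-chains to `q`-chains; it is used for `q = p - 1`, and it is zero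
for the other values of `q`. -/
def boundary (p q : ℤ) : K.Chain p →ₗ[ZMod 2] K.Chain q :=
  Finsupp.linearCombination (ZMod 2) fun σ : K.Simplex p =>
    chainOf {τ : K.Simplex q | q = p - 1 ∧ τ.1 ⊂ σ.1}

/-- The coboundary operator from `p`-chains to `q`-chains; it is used for `q = p + 1`, and it is
zero for the other values of `q`. -/
def coboundary (p q : ℤ) : K.Chain p →ₗ[ZMod 2] K.Chain q :=
  Finsupp.linearCombination (ZMod 2) fun σ : K.Simplex p =>
    chainOf {τ : K.Simplex q | q = p + 1 ∧ σ.1 ⊂ τ.1}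

end Chains

end PreAbstractSimplicialComplex

open PreAbstractSimplicialComplex

/-- A Morse sequence `∅ = K₀, …, Kₖ = K` on `K`. -/
structure MorseSequence {α : Type*} (K : PreAbstractSimplicialComplex α) where
  length : ℕ
  complex : Fin (length + 1) → PreAbstractSimplicialComplex α
  complex_zero : complex 0 = ⊥
  complex_last : complex (Fin.last length) = K
  step : ∀ i : Fin length,
    IsElementaryExpansion (complex i.castSucc) (complex i.succ) ∨
      IsElementaryFilling (complex i.castSucc) (complex i.succ)

namespace MorseSequence

variable {α : Type*} {K : PreAbstractSimplicialComplex α} (W : MorseSequence K)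

def IsCritical (ν : Finset α) : Prop :=
  ∃ i : Fin W.length, IsFillingBy (W.complex i.castSucc) (W.complex i.succ) ν

def IsRegularPair (σ τ : Finset α) : Prop :=
  ∃ i : Fin W.length, IsExpansionBy (W.complex i.castSucc) (W.complex i.succ) σ τ

def IsLowerRegular (σ : Finset α) : Prop := ∃ τ, W.IsRegularPair σ τ

def IsUpperRegular (τ : Finset α) : Prop := ∃ σ, W.IsRegularPair σ τ

/-- The space of the `p`-chains of `K` that are composed of critical simplices. -/
def criticalChain (p : ℤ) : Submodule (ZMod 2) (K.Chain p) :=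
  Finsupp.supported (ZMod 2) (ZMod 2) {ν : K.Simplex p | W.IsCritical ν.1}

/-- A frame on `W` maps each `p`-simplex of `K` to a `p`-chain of critical simplices. -/
abbrev Frame : Type _ := ∀ p : ℤ, K.Simplex p → W.criticalChain p

variable {W} in
/-- The linear extension of a frame to `p`-chains. -/
def Frame.map (Υ : W.Frame) (p : ℤ) : K.Chain p →ₗ[ZMod 2] W.criticalChain p :=
  Finsupp.linearCombination (ZMod 2) (Υ p)

/-- `Υ ν = ν` for each critical simplex `ν`. -/
def FixesCritical (Υ : W.Frame) : Prop :=
  ∀ (p : ℤ) (ν : K.Simplex p), W.IsCritical ν.1 → (Υ p ν : K.Chain p) = Finsupp.single ν 1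

section Maps

variable [Finite K]

/-- Reference maps. An upper regular simplex is written as a `(p + 1)`-simplex, with `p ∈ ℤ`. -/
def IsReferenceMap (Υ : W.Frame) : Prop :=
  W.FixesCritical Υ ∧ ∀ (p : ℤ) (τ : K.Simplex (p + 1)), W.IsUpperRegular τ.1 →
    Υ (p + 1) τ = 0 ∧ Υ.map p (K.boundary (p + 1) p (Finsupp.single τ 1)) = 0

def IsCoreferenceMap (Υ : W.Frame) : Prop :=
  W.FixesCritical Υ ∧ ∀ (p : ℤ) (σ : K.Simplex p), W.IsLowerRegular σ.1 →
    Υ p σ = 0 ∧ Υ.map (p + 1) (K.coboundary p (p + 1) (Finsupp.single σ 1)) = 0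

end Maps

/-! Existence and uniqueness of the reference and coreference maps. -/

theorem complex_mono : Monotone W.complex := by
  refine Fin.monotone_iff_le_succ.2 fun i => ?_
  change (W.complex i.castSucc).faces ⊆ (W.complex i.succ).faces
  rcases W.step i with ⟨σ, τ, -, h⟩ | ⟨ν, -, h⟩ <;> rw [h] <;> exact Set.sdiff_subset

theorem exists_step {ν : Finset α} (hν : ν ∈ K) :
    ∃ i : Fin W.length, ν ∈ W.complex i.succ ∧ ν ∉ W.complex i.castSucc := by
  by_contra! h
  have key : ∀ i : Fin (W.length + 1), ν ∉ W.complex i := by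
    intro i
    induction i using Fin.induction with
    | zero => rw [W.complex_zero]; exact fun h => h
    | succ i ih => exact fun h' => ih (h i h')
  exact key (Fin.last _) (by rw [W.complex_last]; exact hν)

theorem step_lt {ν : Finset α} {i j : Fin W.length} (hi : ν ∉ W.complex i.castSucc)
    (hj : ν ∈ W.complex j.castSucc) : i < j := by
  by_contra! h
  exact hi (W.complex_mono (Fin.castSucc_le_castSucc_iff.2 h) hj)

theorem step_lt' {ν : Finset α} {i j : Fin W.length} (hi : ν ∉ W.complex i.succ)
    (hj : ν ∈ W.complex j.succ) : i < j := by
  by_contra! h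
  exact hi (W.complex_mono (Fin.succ_le_succ_iff.2 h) hj)

theorem step_unique {ν : Finset α} {i j : Fin W.length}
    (hi : ν ∈ W.complex i.succ ∧ ν ∉ W.complex i.castSucc)
    (hj : ν ∈ W.complex j.succ ∧ ν ∉ W.complex j.castSucc) : i = j := by
  rcases lt_trichotomy i j with h | h | h
  · exact absurd (W.complex_mono (Fin.succ_le_castSucc_iff.2 h) hi.1) hj.2
  · exact h
  · exact absurd (W.complex_mono (Fin.succ_le_castSucc_iff.2 h) hj.1) hi.2

/-- The step at which a simplex appears in the sequence. -/
def stepOf {ν : Finset α} (hν : ν ∈ K) : Fin W.length := (W.exists_step hν).choose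

theorem stepOf_spec {ν : Finset α} (hν : ν ∈ K) :
    ν ∈ W.complex (W.stepOf hν).succ ∧ ν ∉ W.complex (W.stepOf hν).castSucc :=
  (W.exists_step hν).choose_spec

theorem added_filling {L M : PreAbstractSimplicialComplex α} {ν : Finset α}
    (h : IsFillingBy L M ν) (μ : Finset α) : μ ∈ M ∧ μ ∉ L ↔ μ = ν := by
  have h1 : μ ∈ L ↔ μ ∈ M ∧ μ ≠ ν := by
    change μ ∈ L.faces ↔ μ ∈ M.faces ∧ _
    rw [h.2]; rfl
  have h2 := h.1.1
  constructor
  · rintro ⟨a, b⟩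
    by_contra hne
    exact b (h1.2 ⟨a, hne⟩)
  · rintro rfl
    exact ⟨h2, fun h => (h1.1 h).2 rfl⟩

theorem freePair_ssubset {M : PreAbstractSimplicialComplex α} {σ τ : Finset α}
    (h : M.IsFreePair σ τ) : σ ⊂ τ := (h.2.2 τ h.2.1).2 rfl

theorem added_expansion {L M : PreAbstractSimplicialComplex α} {σ τ : Finset α}
    (h : IsExpansionBy L M σ τ) (μ : Finset α) : μ ∈ M ∧ μ ∉ L ↔ μ = σ ∨ μ = τ := by
  have h1 : μ ∈ L ↔ μ ∈ M ∧ ¬ (μ = σ ∨ μ = τ) := by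
    change μ ∈ L.faces ↔ μ ∈ M.faces ∧ _
    rw [h.2]; rfl
  constructor
  · rintro ⟨a, b⟩
    by_contra hne
    exact b (h1.2 ⟨a, hne⟩)
  · intro e
    refine ⟨?_, fun h => (h1.1 h).2 e⟩
    rcases e with rfl | rfl
    · exact h.1.1
    · exact h.1.2.1

theorem IsRegularPair.ssubset {W : MorseSequence K} {σ τ : Finset α}
    (h : W.IsRegularPair σ τ) : σ ⊂ τ := freePair_ssubset h.choose_spec.1

theorem complex_le (i : Fin (W.length + 1)) : W.complex i ≤ K := by
  conv_rhs => rw [← W.complex_last]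
  exact W.complex_mono (Fin.le_last i)

theorem IsRegularPair.mem {W : MorseSequence K} {σ τ : Finset α}
    (h : W.IsRegularPair σ τ) : σ ∈ K ∧ τ ∈ K :=
  ⟨W.complex_le _ h.choose_spec.1.1, W.complex_le _ h.choose_spec.1.2.1⟩

theorem IsRegularPair.card {W : MorseSequence K} {σ τ : Finset α}
    (h : W.IsRegularPair σ τ) : τ.card = σ.card + 1 := by
  classical
  obtain ⟨i, ⟨hσ, hτ, hf⟩, -⟩ := h
  have hss : σ ⊂ τ := (hf τ hτ).2 rfl
  obtain ⟨x, hx, hxσ⟩ := Finset.exists_of_ssubset hss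
  have hsub : insert x σ ⊆ τ := Finset.insert_subset hx hss.1
  have hmem : insert x σ ∈ W.complex i.succ :=
    ((W.complex i.succ).isRelLowerSet_faces hτ).2 hsub (Finset.insert_nonempty _ _)
  rw [← (hf _ hmem).1 (Finset.ssubset_insert hxσ), Finset.card_insert_of_notMem hxσ]

theorem IsRegularPair.not_critical {W : MorseSequence K} {σ τ ν : Finset α}
    (h : W.IsRegularPair σ τ) (hν : ν = σ ∨ ν = τ) : ¬ W.IsCritical ν := by
  rintro ⟨j, hj⟩
  obtain ⟨i, hi⟩ := h
  obtain rfl := W.step_unique ((added_expansion hi ν).2 hν) ((added_filling hj ν).2 rfl)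
  have h1 := (added_filling hj σ).1 ((added_expansion hi σ).2 (Or.inl rfl))
  have h2 := (added_filling hj τ).1 ((added_expansion hi τ).2 (Or.inr rfl))
  exact (freePair_ssubset hi.1).ne (h1.trans h2.symm)

theorem IsRegularPair.unique {W : MorseSequence K} {σ τ σ' τ' ν : Finset α}
    (h : W.IsRegularPair σ τ) (h' : W.IsRegularPair σ' τ')
    (hν : ν = σ ∨ ν = τ) (hν' : ν = σ' ∨ ν = τ') : σ = σ' ∧ τ = τ' := by
  obtain ⟨i, hi⟩ := h
  obtain ⟨j, hj⟩ := h'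
  obtain rfl := W.step_unique ((added_expansion hi ν).2 hν) ((added_expansion hj ν).2 hν')
  have h1 := (added_expansion hj σ).1 ((added_expansion hi σ).2 (Or.inl rfl))
  have h2 := (added_expansion hj τ).1 ((added_expansion hi τ).2 (Or.inr rfl))
  have s1 := freePair_ssubset hi.1
  have s2 := freePair_ssubset hj.1
  rcases h1 with rfl | rfl <;> rcases h2 with rfl | rfl
  · exact absurd s1 (ssubset_irrefl _)
  · exact ⟨rfl, rfl⟩
  · exact absurd s1 s2.asymm
  · exact absurd s1 (ssubset_irrefl _)

theorem critical_or_regular {ν : Finset α} (hν : ν ∈ K) :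
    W.IsCritical ν ∨ W.IsLowerRegular ν ∨ W.IsUpperRegular ν := by
  have h := W.stepOf_spec hν
  rcases W.step (W.stepOf hν) with ⟨σ, τ, hs⟩ | ⟨κ, hs⟩
  · rcases (added_expansion hs ν).1 h with rfl | rfl
    · exact Or.inr (Or.inl ⟨τ, _, hs⟩)
    · exact Or.inr (Or.inr ⟨σ, _, hs⟩)
  · obtain rfl := (added_filling hs ν).1 h
    exact Or.inl ⟨_, hs⟩

theorem IsRegularPair.stepOf_lt {W : MorseSequence K} {σ τ μ : Finset α}
    (h : W.IsRegularPair σ τ) (hσ : σ ∈ K) (hμ : μ ∈ K) (hμτ : μ ⊂ τ) (hne : μ ≠ σ) :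
    W.stepOf hμ < W.stepOf hσ := by
  obtain ⟨i, hi⟩ := h
  obtain rfl := W.step_unique ((added_expansion hi σ).2 (Or.inl rfl)) (W.stepOf_spec hσ)
  refine W.step_lt (W.stepOf_spec hμ).2 ?_
  have h1 : μ ∈ W.complex (W.stepOf hσ).succ :=
    ((W.complex (W.stepOf hσ).succ).isRelLowerSet_faces hi.1.2.1).2 hμτ.1
      (K.isRelLowerSet_faces hμ).1
  by_contra h2
  rcases (added_expansion hi μ).1 ⟨h1, h2⟩ with rfl | rfl
  · exact hne rfl
  · exact ssubset_irrefl _ hμτ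

theorem IsRegularPair.lt_stepOf {W : MorseSequence K} {σ τ μ : Finset α}
    (h : W.IsRegularPair σ τ) (hτ : τ ∈ K) (hμ : μ ∈ K) (hσμ : σ ⊂ μ) (hne : μ ≠ τ) :
    W.stepOf hτ < W.stepOf hμ := by
  obtain ⟨i, hi⟩ := h
  obtain rfl := W.step_unique ((added_expansion hi τ).2 (Or.inr rfl)) (W.stepOf_spec hτ)
  refine W.step_lt' (fun h1 => ?_) (W.stepOf_spec hμ).1
  exact hne ((hi.1.2.2 μ h1).1 hσμ)

theorem existsUnique_recursive {S M : Type*} [AddCommMonoid M] (r : S → ℕ) (g : S → M)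
    (N : S → Finset S) (hN : ∀ ν, ∀ μ ∈ N ν, r μ < r ν) :
    ∃! Λ : S → M, ∀ ν, Λ ν = g ν + ∑ μ ∈ N ν, Λ μ := by
  refine ⟨(measure r).wf.fix fun ν F => g ν + ∑ μ ∈ (N ν).attach, F μ.1 (hN ν μ.1 μ.2),
    fun ν => ?_, fun Λ hΛ => ?_⟩
  · rw [WellFounded.fix_eq]
    congr 1
    exact Finset.sum_attach (N ν) _
  · funext ν
    induction ν using (measure r).wf.induction with
    | _ ν ih =>
      rw [hΛ ν, WellFounded.fix_eq]
      congr 1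
      rw [← Finset.sum_attach]
      exact Finset.sum_congr rfl fun μ _ => ih μ.1 (hN ν μ.1 μ.2)

section Maps

variable [Finite K]

theorem _root_.PreAbstractSimplicialComplex.chainOf_eq_sum {p : ℤ} (S : Set (K.Simplex p)) :
    chainOf S = ∑ μ ∈ S.toFinite.toFinset, (Finsupp.single μ 1 : K.Chain p) := by
  classical
  ext ν
  simp [chainOf, Finsupp.finsetSum_apply, Finsupp.single_apply, Set.indicator_apply]

theorem map_chainOf (Υ : W.Frame) {p : ℤ} (S : Set (K.Simplex p)) :
    Υ.map p (chainOf S) = ∑ μ ∈ S.toFinite.toFinset, Υ p μ := by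
  rw [chainOf_eq_sum, map_sum]
  simp [Frame.map]

theorem add_eq_zero_iff_mod_two {M : Type*} [AddCommGroup M] [Module (ZMod 2) M] (a b : M) :
    a + b = 0 ↔ a = b := by
  have hb : b + b = 0 := by
    rw [← two_smul (ZMod 2) b, show (2 : ZMod 2) = 0 from rfl, zero_smul]
  rw [add_eq_zero_iff_eq_neg, neg_eq_of_add_eq_zero_left hb]

open Classical in
/-- The value that a reference map takes at a critical simplex, and zero elsewhere. -/
def criticalPart (p : ℤ) (ν : K.Simplex p) : W.criticalChain p :=
  if h : W.IsCritical ν.1 then ⟨Finsupp.single ν 1, Finsupp.single_mem_supported _ _ h⟩ else 0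

def lowerNext (p : ℤ) (ν : K.Simplex p) : Finset (K.Simplex p) :=
  ({μ | μ ≠ ν ∧ ∃ τ, W.IsRegularPair ν.1 τ ∧ μ.1 ⊂ τ} : Set (K.Simplex p)).toFinite.toFinset

def upperNext (p : ℤ) (ν : K.Simplex p) : Finset (K.Simplex p) :=
  ({μ | μ ≠ ν ∧ ∃ σ, W.IsRegularPair σ ν.1 ∧ σ ⊂ μ.1} : Set (K.Simplex p)).toFinite.toFinset

theorem criticalPart_of_critical {p : ℤ} {ν : K.Simplex p} (h : W.IsCritical ν.1) :
    (W.criticalPart p ν : K.Chain p) = Finsupp.single ν 1 := by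
  simp [criticalPart, h]

theorem criticalPart_of_not {p : ℤ} {ν : K.Simplex p} (h : ¬ W.IsCritical ν.1) :
    W.criticalPart p ν = 0 := by
  simp [criticalPart, h]

theorem lowerNext_of_not {p : ℤ} {ν : K.Simplex p} (h : ¬ W.IsLowerRegular ν.1) :
    W.lowerNext p ν = ∅ := by
  ext μ
  simp only [lowerNext, Set.Finite.mem_toFinset, Set.mem_ofPred_eq, Finset.notMem_empty, iff_false]
  rintro ⟨-, τ, hτ, -⟩
  exact h ⟨τ, hτ⟩

theorem upperNext_of_not {p : ℤ} {ν : K.Simplex p} (h : ¬ W.IsUpperRegular ν.1) :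
    W.upperNext p ν = ∅ := by
  ext μ
  simp only [upperNext, Set.Finite.mem_toFinset, Set.mem_ofPred_eq, Finset.notMem_empty, iff_false]
  rintro ⟨-, τ, hτ, -⟩
  exact h ⟨τ, hτ⟩

theorem map_boundary (Υ : W.Frame) {p : ℤ} {σ : K.Simplex p} {τ : K.Simplex (p + 1)}
    (h : W.IsRegularPair σ.1 τ.1) :
    Υ.map p (K.boundary (p + 1) p (Finsupp.single τ 1)) =
      Υ p σ + ∑ μ ∈ W.lowerNext p σ, Υ p μ := by
  classical
  have hn : σ ∉ W.lowerNext p σ := by simp [lowerNext]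
  rw [boundary, Finsupp.linearCombination_single, one_smul, map_chainOf,
    ← Finset.sum_insert hn]
  refine Finset.sum_congr ?_ fun _ _ => rfl
  ext μ
  simp only [lowerNext, Set.Finite.mem_toFinset, Set.mem_ofPred_eq, Finset.mem_insert,
    add_sub_cancel_right, true_and]
  constructor
  · intro hμ
    by_cases e : μ = σ
    · exact Or.inl e
    · exact Or.inr ⟨e, τ.1, h, hμ⟩
  · rintro (rfl | ⟨-, τ', hτ', hμ⟩)
    · exact h.ssubset
    · rwa [(h.unique hτ' (Or.inl rfl) (Or.inl rfl)).2]

theorem map_coboundary (Υ : W.Frame) {p : ℤ} {σ : K.Simplex p} {τ : K.Simplex (p + 1)}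
    (h : W.IsRegularPair σ.1 τ.1) :
    Υ.map (p + 1) (K.coboundary p (p + 1) (Finsupp.single σ 1)) =
      Υ (p + 1) τ + ∑ μ ∈ W.upperNext (p + 1) τ, Υ (p + 1) μ := by
  classical
  have hn : τ ∉ W.upperNext (p + 1) τ := by simp [upperNext]
  rw [coboundary, Finsupp.linearCombination_single, one_smul, map_chainOf,
    ← Finset.sum_insert hn]
  refine Finset.sum_congr ?_ fun _ _ => rfl
  ext μ
  simp only [upperNext, Set.Finite.mem_toFinset, Set.mem_ofPred_eq, Finset.mem_insert, true_and]
  constructor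
  · intro hμ
    by_cases e : μ = τ
    · exact Or.inl e
    · exact Or.inr ⟨e, σ.1, h, hμ⟩
  · rintro (rfl | ⟨-, σ', hσ', hμ⟩)
    · exact h.ssubset
    · rwa [(h.unique hσ' (Or.inr rfl) (Or.inr rfl)).1]

theorem isReferenceMap_iff (Υ : W.Frame) :
    W.IsReferenceMap Υ ↔ ∀ p, ∀ ν : K.Simplex p,
      Υ p ν = W.criticalPart p ν + ∑ μ ∈ W.lowerNext p ν, Υ p μ := by
  constructor
  · rintro ⟨hc, hr⟩ p ν
    rcases W.critical_or_regular ν.2.1 with h | ⟨τ, h⟩ | h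
    · rw [W.lowerNext_of_not fun ⟨τ, hτ⟩ => hτ.not_critical (Or.inl rfl) h]
      refine Subtype.ext ?_
      simp [hc p ν h, W.criticalPart_of_critical h]
    · rw [W.criticalPart_of_not (h.not_critical (Or.inl rfl)), zero_add,
        ← add_eq_zero_iff_mod_two]
      have hcard := h.card
      have hν := ν.2.2
      let τ' : K.Simplex (p + 1) := ⟨τ, h.mem.2, by rw [hcard]; push_cast; omega⟩
      rw [← W.map_boundary Υ (σ := ν) (τ := τ') h]
      exact (hr p τ' ⟨_, h⟩).2
    · obtain ⟨σ, hσ⟩ := h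
      rw [W.criticalPart_of_not (hσ.not_critical (Or.inr rfl)), W.lowerNext_of_not, zero_add,
        Finset.sum_empty]
      · obtain ⟨q, rfl⟩ : ∃ q, p = q + 1 := ⟨p - 1, by omega⟩
        exact (hr q ν ⟨σ, hσ⟩).1
      · rintro ⟨τ, hτ⟩
        have := hσ.unique hτ (Or.inr rfl) (Or.inl rfl)
        exact hσ.ssubset.ne this.1
  · intro h
    refine ⟨fun p ν hν => ?_, fun p τ hτ => ?_⟩
    · rw [h p ν, W.lowerNext_of_not fun ⟨τ, hτ⟩ => hτ.not_critical (Or.inl rfl) hν]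
      simp [W.criticalPart_of_critical hν]
    · obtain ⟨σ, hσ⟩ := hτ
      constructor
      · rw [h, W.criticalPart_of_not (hσ.not_critical (Or.inr rfl)), W.lowerNext_of_not, zero_add,
          Finset.sum_empty]
        rintro ⟨τ', hτ⟩
        have := hσ.unique hτ (Or.inr rfl) (Or.inl rfl)
        exact hσ.ssubset.ne this.1
      · have hcard := hσ.card
        have hτ2 := τ.2.2
        let σ' : K.Simplex p := ⟨σ, hσ.mem.1, by rw [hcard] at hτ2; push_cast at hτ2; omega⟩
        rw [W.map_boundary Υ (σ := σ') (τ := τ) hσ]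
        refine (add_eq_zero_iff_mod_two (M := W.criticalChain p) _ _).2 ?_
        rw [h p σ', W.criticalPart_of_not (hσ.not_critical (Or.inl rfl)), zero_add]

theorem isCoreferenceMap_iff (Υ : W.Frame) :
    W.IsCoreferenceMap Υ ↔ ∀ p, ∀ ν : K.Simplex p,
      Υ p ν = W.criticalPart p ν + ∑ μ ∈ W.upperNext p ν, Υ p μ := by
  constructor
  · rintro ⟨hc, hr⟩ p ν
    rcases W.critical_or_regular ν.2.1 with h | h | ⟨σ, h⟩
    · rw [W.upperNext_of_not fun ⟨σ, hσ⟩ => hσ.not_critical (Or.inr rfl) h]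
      refine Subtype.ext ?_
      simp [hc p ν h, W.criticalPart_of_critical h]
    · obtain ⟨τ, hτ⟩ := h
      rw [W.criticalPart_of_not (hτ.not_critical (Or.inl rfl)), W.upperNext_of_not, zero_add,
        Finset.sum_empty]
      · exact (hr p ν ⟨τ, hτ⟩).1
      · rintro ⟨σ, hσ⟩
        have := hσ.unique hτ (Or.inr rfl) (Or.inl rfl)
        exact hσ.ssubset.ne this.1
    · obtain ⟨q, rfl⟩ : ∃ q, p = q + 1 := ⟨p - 1, by omega⟩
      rw [W.criticalPart_of_not (h.not_critical (Or.inr rfl)), zero_add,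
        ← add_eq_zero_iff_mod_two]
      have hcard := h.card
      have hν := ν.2.2
      let σ' : K.Simplex q := ⟨σ, h.mem.1, by rw [hcard] at hν; push_cast at hν; omega⟩
      rw [← W.map_coboundary Υ (σ := σ') (τ := ν) h]
      exact (hr q σ' ⟨_, h⟩).2
  · intro h
    refine ⟨fun p ν hν => ?_, fun p σ hσ => ?_⟩
    · rw [h p ν, W.upperNext_of_not fun ⟨σ, hσ⟩ => hσ.not_critical (Or.inr rfl) hν]
      simp [W.criticalPart_of_critical hν]
    · obtain ⟨τ, hτ⟩ := hσ
      constructor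
      · rw [h, W.criticalPart_of_not (hτ.not_critical (Or.inl rfl)), W.upperNext_of_not, zero_add,
          Finset.sum_empty]
        rintro ⟨σ', hσ⟩
        have := hσ.unique hτ (Or.inr rfl) (Or.inl rfl)
        exact hσ.ssubset.ne this.1
      · have hcard := hτ.card
        have hσ2 := σ.2.2
        let τ' : K.Simplex (p + 1) := ⟨τ, hτ.mem.2, by rw [hcard]; push_cast; omega⟩
        rw [W.map_coboundary Υ (σ := σ) (τ := τ') hτ]
        refine (add_eq_zero_iff_mod_two (M := W.criticalChain (p + 1)) _ _).2 ?_
        rw [h (p + 1) τ', W.criticalPart_of_not (hτ.not_critical (Or.inr rfl)), zero_add]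

theorem existsUnique_referenceMap : ∃! Υ : W.Frame, W.IsReferenceMap Υ := by
  have key : ∀ p : ℤ, ∃! Λ : K.Simplex p → W.criticalChain p, ∀ ν,
      Λ ν = W.criticalPart p ν + ∑ μ ∈ W.lowerNext p ν, Λ μ := fun p => by
    refine existsUnique_recursive (fun ν => (W.stepOf ν.2.1 : ℕ)) _ _ fun ν μ hμ => ?_
    simp only [lowerNext, Set.Finite.mem_toFinset, Set.mem_ofPred_eq] at hμ
    obtain ⟨hne, τ, hτ, hμτ⟩ := hμ
    exact hτ.stepOf_lt ν.2.1 μ.2.1 hμτ fun e => hne (Subtype.ext e)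
  choose Λ hΛ hu using key
  exact ⟨Λ, (W.isReferenceMap_iff Λ).2 hΛ, fun Υ hΥ =>
    funext fun p => hu p _ ((W.isReferenceMap_iff Υ).1 hΥ p)⟩

theorem existsUnique_coreferenceMap : ∃! Υ : W.Frame, W.IsCoreferenceMap Υ := by
  have key : ∀ p : ℤ, ∃! Λ : K.Simplex p → W.criticalChain p, ∀ ν,
      Λ ν = W.criticalPart p ν + ∑ μ ∈ W.upperNext p ν, Λ μ := fun p => by
    refine existsUnique_recursive (fun ν => W.length - (W.stepOf ν.2.1 : ℕ)) _ _ fun ν μ hμ => ?_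
    simp only [upperNext, Set.Finite.mem_toFinset, Set.mem_ofPred_eq] at hμ
    obtain ⟨hne, σ, hσ, hσμ⟩ := hμ
    have h1 := hσ.lt_stepOf ν.2.1 μ.2.1 hσμ fun e => hne (Subtype.ext e)
    have h2 := (W.stepOf μ.2.1).isLt
    rw [Fin.lt_def] at h1
    omega
  choose Λ hΛ hu using key
  exact ⟨Λ, (W.isCoreferenceMap_iff Λ).2 hΛ, fun Υ hΥ =>
    funext fun p => hu p _ ((W.isCoreferenceMap_iff Υ).1 hΥ p)⟩

/-! The reference pair, the extension maps and the flows. -/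

/-- The reference map of `W`. -/
def reference : W.Frame := W.existsUnique_referenceMap.choose

theorem reference_spec : W.IsReferenceMap W.reference :=
  W.existsUnique_referenceMap.choose_spec.1

/-- The coreference map of `W`. -/
def coreference : W.Frame := W.existsUnique_coreferenceMap.choose

theorem coreference_spec : W.IsCoreferenceMap W.coreference :=
  W.existsUnique_coreferenceMap.choose_spec.1

/-- The extension map of `W`: the linear map that sends each critical simplex `κ` to the set of the
simplices `ν` such that `κ` belongs to the coreference of `ν`. -/
def extension (p : ℤ) : W.criticalChain p →ₗ[ZMod 2] K.Chain p :=
  (Finsupp.linearCombination (ZMod 2) fun κ : K.Simplex p =>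
    chainOf {ν : K.Simplex p | κ ∈ (W.coreference p ν : K.Chain p).support}) ∘ₗ
    (W.criticalChain p).subtype

/-- The coextension map of `W`: the linear map that sends each critical simplex `κ` to the set of
the simplices `ν` such that `κ` belongs to the reference of `ν`. -/
def coextension (p : ℤ) : W.criticalChain p →ₗ[ZMod 2] K.Chain p :=
  (Finsupp.linearCombination (ZMod 2) fun κ : K.Simplex p =>
    chainOf {ν : K.Simplex p | κ ∈ (W.reference p ν : K.Chain p).support}) ∘ₗ
    (W.criticalChain p).subtype

/-- The map `V` from `p`-chains to `q`-chains (used for `q = p + 1`): it sends `σ` to `τ` for each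
regular pair `(σ, τ)`, and the simplices that are not lower regular to zero. A lower regular
simplex is in exactly one regular pair, so that the set below has at most one element. -/
def gradientV (p q : ℤ) : K.Chain p →ₗ[ZMod 2] K.Chain q :=
  Finsupp.linearCombination (ZMod 2) fun ν : K.Simplex p =>
    chainOf {τ : K.Simplex q | W.IsRegularPair ν.1 τ.1}

/-- The map `V*` from `p`-chains to `q`-chains (used for `q = p - 1`): it sends `τ` to `σ` for each
regular pair `(σ, τ)`, and the simplices that are not upper regular to zero. -/
def cogradientV (p q : ℤ) : K.Chain p →ₗ[ZMod 2] K.Chain q :=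
  Finsupp.linearCombination (ZMod 2) fun ν : K.Simplex p =>
    chainOf {σ : K.Simplex q | W.IsRegularPair σ.1 ν.1}

/-- The gradient flow `Φ = id + ∂V + V∂` on `p`-chains. -/
def flow (p : ℤ) : K.Chain p →ₗ[ZMod 2] K.Chain p :=
  LinearMap.id + K.boundary (p + 1) p ∘ₗ W.gradientV p (p + 1) +
    W.gradientV (p - 1) p ∘ₗ K.boundary p (p - 1)

/-- The coflow `Φ* = id + δV* + V*δ` on `p`-chains. -/
def coflow (p : ℤ) : K.Chain p →ₗ[ZMod 2] K.Chain p :=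
  LinearMap.id + K.coboundary (p - 1) p ∘ₗ W.cogradientV p (p - 1) +
    W.cogradientV (p + 1) p ∘ₗ K.coboundary p (p + 1)

end Maps

end MorseSequence

open Classical in
/-- The stable value `f^i(c)` of the iterates of `f` at `c`, where `f^(i+1)(c) = f^i(c)`; it does not
depend on `i`. The value is `c` if there is no such `i`. -/
def stableValue {M : Type*} (f : M → M) (c : M) : M :=
  if h : ∃ i : ℕ, f^[i + 1] c = f^[i] c then f^[h.choose] c else c

theorem stableValue_eq {M : Type*} {f : M → M} {c : M} {i : ℕ} (hi : f^[i + 1] c = f^[i] c) :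
    stableValue f c = f^[i] c := by
  have aux : ∀ i j : ℕ, f^[i + 1] c = f^[i] c → i ≤ j → f^[j] c = f^[i] c := by
    intro i j h hij
    induction j, hij using Nat.le_induction with
    | base => rfl
    | succ j _ ih => rw [Function.iterate_succ_apply', ih, ← Function.iterate_succ_apply' f i c, h]
  have h : ∃ i : ℕ, f^[i + 1] c = f^[i] c := ⟨i, hi⟩
  rw [stableValue, dif_pos h]
  rcases le_total h.choose i with hle | hle
  · exact (aux _ _ h.choose_spec hle).symm
  · exact aux _ _ hi hle

namespace MorseSequence

variable {α : Type*} {K : PreAbstractSimplicialComplex α} (W : MorseSequence K) [Finite K]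

/-- The stabilized gradient flow on `p`-chains. -/
def stableFlow (p : ℤ) (c : K.Chain p) : K.Chain p := stableValue (W.flow p) c

/-- The stabilized coflow on `p`-chains. -/
def stableCoflow (p : ℤ) (c : K.Chain p) : K.Chain p := stableValue (W.coflow p) c

end MorseSequence

end

/-! Two facts pin down the limit of the flow `Φ`. The reference map is invariant under `Φ`
(`referenceChain_flow`), because it kills the images of `V` and of `∂V`. Every extension is a fixed
point of `Φ` (`flow_extensionChain`): the coreference map kills the images of `V*` and of `δV*`, and
transposing this for the mod 2 pairing shows that `V` and `V∂` vanish on extensions.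

It remains to see that the iterates of each simplex do reach the extension of its reference. Chains
with this property form a subspace `stabilizing`, and a chain belongs to it as soon as its image
under `Φ` does. For a regular simplex, working mod 2, the simplex cancels out of its own image. What
is left for an upper regular one is a sum of upper regular simplices that appear earlier in the
sequence; for a lower regular one, earlier simplices plus a chain in the image of `V`. Induction on
the step of appearance then applies. A critical simplex `κ` differs from its extension, a fixed
point with reference `κ`, by upper regular simplices only.

The coflow needs no second argument: it is the transpose of the flow, and transposition turns
extension after reference into coextension after coreference. -/

namespace PreAbstractSimplicialComplex

variable {α : Type*} {K : PreAbstractSimplicialComplex α} [Finite K]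

/-! ### Chains as sums of simplices. -/

theorem map_chainOf_mem {p : ℤ} {M : Type*} [AddCommMonoid M] [Module (ZMod 2) M]
    (f : K.Chain p →ₗ[ZMod 2] M) (N : Submodule (ZMod 2) M) {S : Set (K.Simplex p)}
    (h : ∀ μ ∈ S, f (Finsupp.single μ 1) ∈ N) : f (chainOf S) ∈ N := by
  rw [chainOf_eq_sum, map_sum]
  exact N.sum_mem fun μ hμ => h μ (by simpa using hμ)

theorem chainOf_mem {p : ℤ} (N : Submodule (ZMod 2) (K.Chain p)) {S : Set (K.Simplex p)}
    (h : ∀ μ ∈ S, Finsupp.single μ 1 ∈ N) : chainOf S ∈ N :=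
  map_chainOf_mem LinearMap.id N h

theorem map_chainOf_eq_zero {p : ℤ} {M : Type*} [AddCommMonoid M] [Module (ZMod 2) M]
    (f : K.Chain p →ₗ[ZMod 2] M) {S : Set (K.Simplex p)}
    (h : ∀ μ ∈ S, f (Finsupp.single μ 1) = 0) : f (chainOf S) = 0 := by
  simpa using map_chainOf_mem f ⊥ (S := S) (by simpa using h)

/-- Isolates one simplex of a boundary, so that its contribution to the flow can be cancelled mod 2.
-/
theorem chainOf_eq_single_add {p : ℤ} {S : Set (K.Simplex p)} {ν : K.Simplex p} (h : ν ∈ S) :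
    (chainOf S : K.Chain p) = Finsupp.single ν 1 + chainOf (S \ {ν}) := by
  classical
  ext μ
  by_cases e : μ = ν
  · subst e; simp [chainOf, h]
  · by_cases hS : μ ∈ S <;> simp [chainOf, e, hS]

theorem chainOf_apply {p : ℤ} (S : Set (K.Simplex p)) (ν : K.Simplex p) [Decidable (ν ∈ S)] :
    (chainOf S : K.Chain p) ν = if ν ∈ S then 1 else 0 := by
  simp [chainOf, Set.indicator_apply]

theorem chain_add_self {p : ℤ} (c : K.Chain p) : c + c = 0 :=
  (MorseSequence.add_eq_zero_iff_mod_two c c).2 rfl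

/-! ### The mod 2 pairing and transposition of linear maps. -/

variable (K) in
/-- The pairing of two chains: the parity of the size of their intersection. -/
noncomputable def pairing (p : ℤ) : K.Chain p →ₗ[ZMod 2] K.Chain p →ₗ[ZMod 2] ZMod 2 :=
  Finsupp.linearCombination (ZMod 2) fun ν : K.Simplex p => Finsupp.lapply ν

theorem pairing_single_left {p : ℤ} (ν : K.Simplex p) (c : K.Chain p) :
    K.pairing p (Finsupp.single ν 1) c = c ν := by
  simp [pairing]

theorem pairing_single_right {p : ℤ} (ν : K.Simplex p) (c : K.Chain p) :
    K.pairing p c (Finsupp.single ν 1) = c ν := by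
  classical
  induction c using Finsupp.induction_linear with
  | zero => simp
  | add f g hf hg => simp [hf, hg]
  | single μ a => simp [pairing, Finsupp.single_apply, eq_comm]

theorem isAdjointPair_of_single {p q : ℤ} {f : K.Chain p →ₗ[ZMod 2] K.Chain q}
    {g : K.Chain q →ₗ[ZMod 2] K.Chain p}
    (h : ∀ μ ν, f (Finsupp.single μ 1) ν = g (Finsupp.single ν 1) μ) :
    LinearMap.IsAdjointPair (K.pairing p) (K.pairing q) f g := by
  have key : (K.pairing q).comp f = (K.pairing p).compl₂ g := by
    ext μ ν
    simp [pairing_single_left, pairing_single_right, h]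
  exact fun x y => LinearMap.congr_fun₂ key x y

/-- The matrix of a map that sends each simplex to the set of its related simplices is the indicator
of the relation; the converse relation gives the transposed matrix. This covers both `∂`, `δ` and
`V`, `V*`. -/
theorem isAdjointPair_of_relation {p q : ℤ} (r : K.Simplex p → K.Simplex q → Prop)
    (s : K.Simplex q → K.Simplex p → Prop) (h : ∀ μ ν, r μ ν ↔ s ν μ) :
    LinearMap.IsAdjointPair (K.pairing p) (K.pairing q)
      (Finsupp.linearCombination (ZMod 2) fun μ => (chainOf {ν | r μ ν} : K.Chain q))
      (Finsupp.linearCombination (ZMod 2) fun ν => (chainOf {μ | s ν μ} : K.Chain p)) := by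
  classical
  refine isAdjointPair_of_single fun μ ν => ?_
  simp [chainOf_apply, h]

/-- A map with zero adjoint is zero. -/
theorem eq_zero_of_isAdjointPair {p q : ℤ} {f : K.Chain p →ₗ[ZMod 2] K.Chain q}
    {g : K.Chain q →ₗ[ZMod 2] K.Chain p}
    (h : LinearMap.IsAdjointPair (K.pairing p) (K.pairing q) f g) (hf : f = 0) : g = 0 := by
  ext ν μ
  have := h (Finsupp.single μ 1) (Finsupp.single ν 1)
  rw [pairing_single_left, hf] at this
  simpa using this.symm

/-- Keeping `p` and `q` as variables tied by an equation serves both index pairs of the flow, `(p +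
1, p)` and `(p, p - 1)`, without casts between chain spaces. -/
theorem isAdjointPair_boundary (p q : ℤ) (h : p = q + 1) :
    LinearMap.IsAdjointPair (K.pairing p) (K.pairing q) (K.boundary p q) (K.coboundary q p) :=
  isAdjointPair_of_relation (fun μ ν => q = p - 1 ∧ ν.1 ⊂ μ.1) (fun ν μ => p = q + 1 ∧ ν.1 ⊂ μ.1)
    fun μ ν => by simp [h]

theorem isAdjointPair_symm {p q : ℤ} {f : K.Chain p →ₗ[ZMod 2] K.Chain q}
    {g : K.Chain q →ₗ[ZMod 2] K.Chain p}
    (h : LinearMap.IsAdjointPair (K.pairing p) (K.pairing q) f g) :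
    LinearMap.IsAdjointPair (K.pairing q) (K.pairing p) g f := by
  refine isAdjointPair_of_single fun μ ν => ?_
  have := h (Finsupp.single ν 1) (Finsupp.single μ 1)
  rw [pairing_single_left, pairing_single_right] at this
  exact this.symm

theorem isAdjointPair_comp {p q r : ℤ} {f : K.Chain p →ₗ[ZMod 2] K.Chain q}
    {g : K.Chain q →ₗ[ZMod 2] K.Chain p} {f' : K.Chain q →ₗ[ZMod 2] K.Chain r}
    {g' : K.Chain r →ₗ[ZMod 2] K.Chain q}
    (h : LinearMap.IsAdjointPair (K.pairing p) (K.pairing q) f g)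
    (h' : LinearMap.IsAdjointPair (K.pairing q) (K.pairing r) f' g') :
    LinearMap.IsAdjointPair (K.pairing p) (K.pairing r) (f' ∘ₗ f) (g ∘ₗ g') := fun x y =>
  (h' (f x) y).trans (h x (g' y))

end PreAbstractSimplicialComplex

namespace MorseSequence

open PreAbstractSimplicialComplex

variable {α : Type*} {K : PreAbstractSimplicialComplex α} {W : MorseSequence K}

/-! ### Regular pairs and the values of `V` on simplices. -/

theorem IsRegularPair.stepOf_eq {σ τ : Finset α} (h : W.IsRegularPair σ τ) (hσ : σ ∈ K)
    (hτ : τ ∈ K) : W.stepOf hσ = W.stepOf hτ := by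
  obtain ⟨i, hi⟩ := h
  exact (W.step_unique (W.stepOf_spec hσ) ((added_expansion hi σ).2 (Or.inl rfl))).trans
    (W.step_unique ((added_expansion hi τ).2 (Or.inr rfl)) (W.stepOf_spec hτ))

theorem IsRegularPair.not_lower {σ τ : Finset α} (h : W.IsRegularPair σ τ) :
    ¬ W.IsLowerRegular τ := fun ⟨_, h'⟩ =>
  h.ssubset.ne (h.unique h' (Or.inr rfl) (Or.inl rfl)).1

theorem IsCritical.not_lower {ν : Finset α} (h : W.IsCritical ν) : ¬ W.IsLowerRegular ν :=
  fun ⟨_, h'⟩ => h'.not_critical (Or.inl rfl) h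

variable [Finite K]

theorem boundary_single {p q : ℤ} (σ : K.Simplex p) :
    K.boundary p q (Finsupp.single σ 1) = chainOf {τ : K.Simplex q | q = p - 1 ∧ τ.1 ⊂ σ.1} := by
  simp [boundary]

theorem gradientV_single {p q : ℤ} (σ : K.Simplex p) :
    W.gradientV p q (Finsupp.single σ 1) =
      chainOf {τ : K.Simplex q | W.IsRegularPair σ.1 τ.1} := by
  simp [gradientV]

theorem cogradientV_single {p q : ℤ} (τ : K.Simplex p) :
    W.cogradientV p q (Finsupp.single τ 1) =
      chainOf {σ : K.Simplex q | W.IsRegularPair σ.1 τ.1} := by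
  simp [cogradientV]

theorem gradientV_of_pair {p q : ℤ} {σ : K.Simplex p} {τ : K.Simplex q}
    (h : W.IsRegularPair σ.1 τ.1) :
    W.gradientV p q (Finsupp.single σ 1) = Finsupp.single τ 1 := by
  classical
  rw [gradientV_single]
  ext μ
  rw [chainOf_apply, Finsupp.single_apply]
  refine if_congr ⟨fun h' => ?_, fun e => e ▸ h⟩ rfl rfl
  exact Subtype.ext (h.unique h' (Or.inl rfl) (Or.inl rfl)).2

theorem gradientV_of_not {p q : ℤ} {ν : K.Simplex p} (h : ¬ W.IsLowerRegular ν.1) :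
    W.gradientV p q (Finsupp.single ν 1) = 0 := by
  rw [gradientV_single]
  exact map_chainOf_eq_zero LinearMap.id fun τ hτ => (h ⟨_, hτ⟩).elim

theorem IsRegularPair.upper_eq {p : ℤ} {σ : K.Simplex p} {τ : Finset α}
    (h : W.IsRegularPair σ.1 τ) : ∃ τ' : K.Simplex (p + 1), τ'.1 = τ :=
  ⟨⟨τ, h.mem.2, by have := h.card; have := σ.2.2; omega⟩, rfl⟩

theorem IsRegularPair.lower_eq {p : ℤ} {σ : Finset α} {τ : K.Simplex p}
    (h : W.IsRegularPair σ τ.1) : ∃ σ' : K.Simplex (p - 1), σ'.1 = σ :=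
  ⟨⟨σ, h.mem.1, by have := h.card; have := τ.2.2; omega⟩, rfl⟩

/-! ### Reference, coreference and flow, with their transposes. -/

variable (W)

/-- The reference map, with values in the space of all chains. -/
noncomputable def referenceChain (p : ℤ) : K.Chain p →ₗ[ZMod 2] K.Chain p :=
  (W.criticalChain p).subtype ∘ₗ W.reference.map p

/-- The coreference map, with values in the space of all chains. -/
noncomputable def coreferenceChain (p : ℤ) : K.Chain p →ₗ[ZMod 2] K.Chain p :=
  (W.criticalChain p).subtype ∘ₗ W.coreference.map p

/-- The transpose of the coreference map. -/
noncomputable def extensionChain (p : ℤ) : K.Chain p →ₗ[ZMod 2] K.Chain p :=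
  Finsupp.linearCombination (ZMod 2) fun κ : K.Simplex p =>
    chainOf {ν : K.Simplex p | κ ∈ (W.coreference p ν : K.Chain p).support}

/-- The transpose of the reference map. -/
noncomputable def coextensionChain (p : ℤ) : K.Chain p →ₗ[ZMod 2] K.Chain p :=
  Finsupp.linearCombination (ZMod 2) fun κ : K.Simplex p =>
    chainOf {ν : K.Simplex p | κ ∈ (W.reference p ν : K.Chain p).support}

theorem referenceChain_single {p : ℤ} (ν : K.Simplex p) :
    W.referenceChain p (Finsupp.single ν 1) = W.reference p ν := by
  simp [referenceChain, Frame.map]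

theorem coreferenceChain_single {p : ℤ} (ν : K.Simplex p) :
    W.coreferenceChain p (Finsupp.single ν 1) = W.coreference p ν := by
  simp [coreferenceChain, Frame.map]

/-- Over `ZMod 2` a coefficient is the indicator of membership in the support; this links the
set-based definition of the extension maps to matrix entries. -/
theorem _root_.ZMod.eq_ite_of_two (a : ZMod 2) : a = if a ≠ 0 then 1 else 0 := by
  revert a; decide

theorem isAdjointPair_coreferenceChain (p : ℤ) :
    LinearMap.IsAdjointPair (K.pairing p) (K.pairing p) (W.coreferenceChain p)
      (W.extensionChain p) := by
  classical
  refine isAdjointPair_of_single fun μ ν => ?_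
  rw [coreferenceChain_single, extensionChain, Finsupp.linearCombination_single, one_smul,
    chainOf_apply]
  simpa using ZMod.eq_ite_of_two _

theorem isAdjointPair_referenceChain (p : ℤ) :
    LinearMap.IsAdjointPair (K.pairing p) (K.pairing p) (W.referenceChain p)
      (W.coextensionChain p) := by
  classical
  refine isAdjointPair_of_single fun μ ν => ?_
  rw [referenceChain_single, coextensionChain, Finsupp.linearCombination_single, one_smul,
    chainOf_apply]
  simpa using ZMod.eq_ite_of_two _

theorem isAdjointPair_gradientV (p q : ℤ) :
    LinearMap.IsAdjointPair (K.pairing p) (K.pairing q) (W.gradientV p q) (W.cogradientV q p) :=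
  isAdjointPair_of_relation _ _ fun _ _ => Iff.rfl

/-- Transposition reverses composition: `∂V` becomes `V*δ` and `V∂` becomes `δV*`, so the two
correction terms are exchanged. -/
theorem isAdjointPair_flow (p : ℤ) :
    LinearMap.IsAdjointPair (K.pairing p) (K.pairing p) (W.flow p) (W.coflow p) := by
  have h1 := isAdjointPair_comp (W.isAdjointPair_gradientV p (p + 1))
    (isAdjointPair_boundary (K := K) (p + 1) p rfl)
  have h2 := isAdjointPair_comp (isAdjointPair_boundary (K := K) p (p - 1) (by omega))
    (W.isAdjointPair_gradientV (p - 1) p)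
  intro x y
  have e1 := h1 x y
  have e2 := h2 x y
  simp only [flow, coflow, LinearMap.add_apply, LinearMap.comp_apply,
    LinearMap.id_apply, map_add] at e1 e2 ⊢
  rw [e1, e2]
  abel

/-! ### Vanishing identities, and their consequences for the flow. -/

theorem referenceChain_critical {p : ℤ} {κ : K.Simplex p} (h : W.IsCritical κ.1) :
    W.referenceChain p (Finsupp.single κ 1) = Finsupp.single κ 1 :=
  (W.referenceChain_single κ).trans (W.reference_spec.1 p κ h)

theorem referenceChain_upper {p : ℤ} {τ : K.Simplex p} (h : W.IsUpperRegular τ.1) :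
    W.referenceChain p (Finsupp.single τ 1) = 0 := by
  obtain ⟨q, rfl⟩ : ∃ q, p = q + 1 := ⟨p - 1, by omega⟩
  rw [referenceChain_single, (W.reference_spec.2 q τ h).1]; rfl

theorem coreferenceChain_lower {p : ℤ} {σ : K.Simplex p} (h : W.IsLowerRegular σ.1) :
    W.coreferenceChain p (Finsupp.single σ 1) = 0 := by
  rw [coreferenceChain_single, (W.coreference_spec.2 p σ h).1]; rfl

theorem referenceChain_comp_gradientV (p q : ℤ) :
    W.referenceChain p ∘ₗ W.gradientV q p = 0 := by
  ext1 ν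
  ext1
  simp only [LinearMap.comp_apply, Finsupp.lsingle_apply, gradientV_single, LinearMap.zero_apply]
  exact map_chainOf_eq_zero _ fun τ hτ => W.referenceChain_upper ⟨_, hτ⟩

theorem referenceChain_comp_boundary_comp_gradientV (p : ℤ) :
    W.referenceChain p ∘ₗ K.boundary (p + 1) p ∘ₗ W.gradientV p (p + 1) = 0 := by
  ext1 ν
  ext1
  simp only [LinearMap.comp_apply, Finsupp.lsingle_apply, gradientV_single, LinearMap.zero_apply]
  refine map_chainOf_eq_zero (W.referenceChain p ∘ₗ K.boundary (p + 1) p) fun τ hτ => ?_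
  simp [referenceChain, (W.reference_spec.2 p τ ⟨_, hτ⟩).2]

theorem coreferenceChain_comp_cogradientV (p q : ℤ) :
    W.coreferenceChain p ∘ₗ W.cogradientV q p = 0 := by
  ext1 ν
  ext1
  simp only [LinearMap.comp_apply, Finsupp.lsingle_apply, cogradientV_single, LinearMap.zero_apply]
  exact map_chainOf_eq_zero _ fun τ hτ => W.coreferenceChain_lower ⟨_, hτ⟩

theorem coreferenceChain_comp_coboundary_comp_cogradientV (p q : ℤ) (h : p = q + 1) :
    W.coreferenceChain p ∘ₗ K.coboundary q p ∘ₗ W.cogradientV p q = 0 := by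
  subst h
  ext1 ν
  ext1
  simp only [LinearMap.comp_apply, Finsupp.lsingle_apply, cogradientV_single, LinearMap.zero_apply]
  refine map_chainOf_eq_zero (W.coreferenceChain (q + 1) ∘ₗ K.coboundary q (q + 1)) fun τ hτ => ?_
  simp [coreferenceChain, (W.coreference_spec.2 q τ ⟨_, hτ⟩).2]

/-- Transpose of the fact that the coreference vanishes on lower regular simplices, which span the
image of `V*`. -/
theorem gradientV_comp_extensionChain (p q : ℤ) :
    W.gradientV p q ∘ₗ W.extensionChain p = 0 :=
  eq_zero_of_isAdjointPair
    (isAdjointPair_comp (isAdjointPair_symm (W.isAdjointPair_gradientV p q))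
      (W.isAdjointPair_coreferenceChain p))
    (W.coreferenceChain_comp_cogradientV p q)

/-- Transpose of the second defining condition of the coreference, its vanishing on coboundaries of
lower regular simplices. -/
theorem gradientV_comp_boundary_comp_extensionChain (p q : ℤ) (h : p = q + 1) :
    W.gradientV q p ∘ₗ K.boundary p q ∘ₗ W.extensionChain p = 0 :=
  eq_zero_of_isAdjointPair
    (isAdjointPair_comp (isAdjointPair_symm (W.isAdjointPair_gradientV q p))
      (isAdjointPair_comp (isAdjointPair_symm (isAdjointPair_boundary p q h))
        (W.isAdjointPair_coreferenceChain p)))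
    (W.coreferenceChain_comp_coboundary_comp_cogradientV p q h)

theorem flow_apply {p : ℤ} (c : K.Chain p) :
    W.flow p c = c + K.boundary (p + 1) p (W.gradientV p (p + 1) c) +
      W.gradientV (p - 1) p (K.boundary p (p - 1) c) := rfl

theorem referenceChain_flow {p : ℤ} (c : K.Chain p) :
    W.referenceChain p (W.flow p c) = W.referenceChain p c := by
  have h1 := LinearMap.congr_fun (W.referenceChain_comp_boundary_comp_gradientV p) c
  have h2 := LinearMap.congr_fun (W.referenceChain_comp_gradientV p (p - 1))
    (K.boundary p (p - 1) c)
  simp only [LinearMap.comp_apply, LinearMap.zero_apply] at h1 h2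
  rw [flow_apply, map_add, map_add, h1, h2, add_zero, add_zero]

theorem flow_extensionChain {p : ℤ} (c : K.Chain p) :
    W.flow p (W.extensionChain p c) = W.extensionChain p c := by
  have h1 := LinearMap.congr_fun (W.gradientV_comp_extensionChain p (p + 1)) c
  have h2 := LinearMap.congr_fun
    (W.gradientV_comp_boundary_comp_extensionChain p (p - 1) (by omega)) c
  simp only [LinearMap.comp_apply, LinearMap.zero_apply] at h1 h2
  rw [flow_apply, h1, h2, map_zero, add_zero, add_zero]

/-! ### Convergence of the iterated flow. -/

theorem flow_iterate_extensionChain {p : ℤ} (c : K.Chain p) (i : ℕ) :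
    (W.flow p)^[i] (W.extensionChain p c) = W.extensionChain p c :=
  Function.iterate_fixed (W.flow_extensionChain c) i

theorem flow_iterate_of_le {p : ℤ} {c d : K.Chain p} {i j : ℕ} (hij : i ≤ j)
    (h : (W.flow p)^[i] c = W.extensionChain p d) :
    (W.flow p)^[j] c = W.extensionChain p d := by
  rw [← Nat.sub_add_cancel hij, Function.iterate_add_apply, h, flow_iterate_extensionChain]

/-- The chains that the iterates of the flow bring to the extension of their reference. -/
noncomputable def stabilizing (p : ℤ) : Submodule (ZMod 2) (K.Chain p) where
  carrier := {c | ∃ i : ℕ, (W.flow p)^[i] c = W.extensionChain p (W.referenceChain p c)}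
  zero_mem' := ⟨0, by simp⟩
  add_mem' := by
    rintro a b ⟨i, hi⟩ ⟨j, hj⟩
    refine ⟨max i j, ?_⟩
    rw [iterate_map_add, W.flow_iterate_of_le (le_max_left i j) hi,
      W.flow_iterate_of_le (le_max_right i j) hj, map_add, map_add]
  smul_mem' := by
    rintro r c ⟨i, hi⟩
    refine ⟨i, ?_⟩
    rw [← Module.End.pow_apply] at hi ⊢
    rw [map_smul, hi, map_smul, map_smul]

theorem mem_stabilizing_of_flow {p : ℤ} {c : K.Chain p} (h : W.flow p c ∈ W.stabilizing p) :
    c ∈ W.stabilizing p := by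
  obtain ⟨i, hi⟩ := h
  exact ⟨i + 1, by rw [Function.iterate_succ_apply, hi, referenceChain_flow]⟩

/-- Since `V` kills `τ`, only `τ + V∂τ` remains. The partner `σ` contributes `τ` to `V∂τ`, which
cancels the first term; every other face `μ` in `∂τ` appears earlier and contributes zero or an
upper regular simplex of the same step as `μ`. -/
theorem upper_mem_stabilizing {p : ℤ} (τ : K.Simplex p) (h : W.IsUpperRegular τ.1) :
    Finsupp.single τ 1 ∈ W.stabilizing p := by
  induction hn : W.stepOf τ.2.1 using WellFoundedLT.induction generalizing τ with
  | ind n ih =>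
  obtain ⟨σ, hσ⟩ := h
  obtain ⟨σ, rfl⟩ := hσ.lower_eq
  have hmem : σ ∈ {μ : K.Simplex (p - 1) | p - 1 = p - 1 ∧ μ.1 ⊂ τ.1} := ⟨rfl, hσ.ssubset⟩
  apply W.mem_stabilizing_of_flow
  rw [flow_apply, gradientV_of_not hσ.not_lower, map_zero, add_zero, boundary_single,
    chainOf_eq_single_add hmem, map_add, gradientV_of_pair hσ, ← add_assoc, chain_add_self,
    zero_add]
  refine map_chainOf_mem _ _ fun μ hμ => ?_
  rw [gradientV_single]
  refine chainOf_mem _ fun τ' hτ' => ih _ ?_ τ' ⟨_, hτ'⟩ rfl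
  -- The two members of a regular pair share their step, so comparing `τ'` with `τ` reduces to
  -- comparing `μ` with `σ`.
  rw [← hn, ← IsRegularPair.stepOf_eq hτ' μ.2.1 τ'.2.1, ← hσ.stepOf_eq σ.2.1 τ.2.1]
  exact hσ.stepOf_lt σ.2.1 μ.2.1 hμ.1.2 fun e => hμ.2 (Subtype.ext e)

theorem gradientV_mem_stabilizing {p q : ℤ} (c : K.Chain q) :
    W.gradientV q p c ∈ W.stabilizing p := by
  induction c using Finsupp.induction_linear with
  | zero => simp
  | add f g hf hg => rw [map_add]; exact Submodule.add_mem _ hf hg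
  | single μ a =>
    rw [← mul_one a, ← smul_eq_mul, ← Finsupp.smul_single, map_smul, gradientV_single]
    exact Submodule.smul_mem _ _ (chainOf_mem _ fun τ hτ => W.upper_mem_stabilizing τ ⟨_, hτ⟩)

/-- No descent on `κ` is needed: its extension is `κ` plus upper regular simplices, which are
already known to stabilize, so `κ` stabilizes if and only if its extension does. -/
theorem critical_mem_stabilizing {p : ℤ} (κ : K.Simplex p) (h : W.IsCritical κ.1) :
    Finsupp.single κ 1 ∈ W.stabilizing p := by
  classical
  set S : Set (K.Simplex p) := {ν | κ ∈ (W.coreference p ν : K.Chain p).support} with hS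
  have hκ : κ ∈ S := by simp [hS, W.coreference_spec.1 p κ h]
  have hE : W.extensionChain p (Finsupp.single κ 1) = Finsupp.single κ 1 + chainOf (S \ {κ}) := by
    rw [← chainOf_eq_single_add hκ]
    simp [extensionChain, hS]
  -- The coreference of a critical simplex is itself and that of a lower regular one is zero, so
  -- neither type contributes to `S` beyond `κ`.
  have hU : ∀ ν ∈ S \ {κ}, W.IsUpperRegular ν.1 := by
    rintro ν ⟨hν, hne⟩
    rcases W.critical_or_regular ν.2.1 with hc | hl | hu
    · rw [hS, Set.mem_ofPred_eq, W.coreference_spec.1 p ν hc] at hν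
      exact (hne (by simpa [Finsupp.single_apply, eq_comm] using hν)).elim
    · rw [hS, Set.mem_ofPred_eq, (W.coreference_spec.2 p ν hl).1] at hν
      simp at hν
    · exact hu
  have h1 : chainOf (S \ {κ}) ∈ W.stabilizing p :=
    chainOf_mem _ fun ν hν => W.upper_mem_stabilizing ν (hU ν hν)
  have h2 : W.extensionChain p (Finsupp.single κ 1) ∈ W.stabilizing p := by
    -- Zero iterations suffice: the reference kills the upper regular terms, so the reference of the
    -- extension is `κ` again.
    refine ⟨0, ?_⟩
    have : W.referenceChain p (chainOf (S \ {κ})) = 0 :=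
      map_chainOf_eq_zero _ fun ν hν => W.referenceChain_upper (hU ν hν)
    rw [Function.iterate_zero_apply]
    congr 1
    rw [hE, map_add, this, add_zero, W.referenceChain_critical h]
  rw [hE] at h2
  exact (Submodule.add_mem_iff_left _ h1).1 h2

theorem single_mem_stabilizing {p : ℤ} (ν : K.Simplex p) :
    Finsupp.single ν 1 ∈ W.stabilizing p := by
  induction hn : W.stepOf ν.2.1 using WellFoundedLT.induction generalizing ν with
  | ind n ih =>
  rcases W.critical_or_regular ν.2.1 with h | ⟨τ, hτ⟩ | h
  · exact W.critical_mem_stabilizing ν h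
  · obtain ⟨τ, rfl⟩ := hτ.upper_eq
    -- Here the term `∂V` provides the cancellation: `∂τ` contains `ν`, and its other faces appear
    -- earlier. The term `V∂` lies in the image of `V`, hence is already settled.
    have hmem : ν ∈ {μ : K.Simplex p | p = p + 1 - 1 ∧ μ.1 ⊂ τ.1} := ⟨by omega, hτ.ssubset⟩
    apply W.mem_stabilizing_of_flow
    rw [flow_apply, gradientV_of_pair hτ, boundary_single, chainOf_eq_single_add hmem,
      ← add_assoc, chain_add_self, zero_add]
    refine Submodule.add_mem _ (chainOf_mem _ fun μ hμ => ih _ ?_ μ rfl)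
      (W.gradientV_mem_stabilizing _)
    rw [← hn]
    exact hτ.stepOf_lt ν.2.1 μ.2.1 hμ.1.2 fun e => hμ.2 (Subtype.ext e)
  · exact W.upper_mem_stabilizing ν h

/-- Some iterate of the flow is the composition of the reference map and the extension map. -/
theorem exists_flow_iterate_eq (p : ℤ) : ∃ N : ℕ, ∀ i ≥ N, ∀ c : K.Chain p,
    (W.flow p)^[i] c = W.extensionChain p (W.referenceChain p c) := by
  choose n hn using fun ν : K.Simplex p => W.single_mem_stabilizing ν
  -- There are finitely many `p`-simplices, so one exponent works for all of them, and by linearity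
  -- for all chains.
  obtain ⟨N, hN⟩ := (Set.finite_range n).bddAbove
  refine ⟨N, fun i hi c => ?_⟩
  rw [← Module.End.pow_apply]
  change _ = (W.extensionChain p ∘ₗ W.referenceChain p) c
  congr 1
  ext1 ν
  ext1
  simp only [LinearMap.comp_apply, Finsupp.lsingle_apply, Module.End.pow_apply]
  exact W.flow_iterate_of_le ((hN ⟨ν, rfl⟩).trans hi) (hn ν)

/-! ### Passage to the coflow by transposition. -/

theorem pairing_flow_iterate {p : ℤ} (i : ℕ) (c d : K.Chain p) :
    K.pairing p ((W.flow p)^[i] c) d = K.pairing p c ((W.coflow p)^[i] d) := by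
  induction i generalizing c with
  | zero => rfl
  | succ i ih =>
    rw [Function.iterate_succ_apply, ih, W.isAdjointPair_flow p, Function.iterate_succ_apply']

/-- Some iterate of the coflow is the composition of the coreference map and the coextension
map. -/
theorem exists_coflow_iterate_eq (p : ℤ) : ∃ N : ℕ, ∀ i ≥ N, ∀ c : K.Chain p,
    (W.coflow p)^[i] c = W.coextensionChain p (W.coreferenceChain p c) := by
  obtain ⟨N, hN⟩ := W.exists_flow_iterate_eq p
  refine ⟨N, fun i hi c => ?_⟩
  ext ν
  rw [← pairing_single_left, ← pairing_single_left, ← pairing_flow_iterate, hN i hi,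
    isAdjointPair_symm (W.isAdjointPair_coreferenceChain p), W.isAdjointPair_referenceChain p]

end MorseSequence

theorem mainTheorem2 {α : Type*} (K : PreAbstractSimplicialComplex α) [Finite K]
    (W : MorseSequence K) (p : ℤ) :
    ((∀ c : K.Chain p, ∃ i : ℕ, (W.flow p)^[i + 1] c = (W.flow p)^[i] c) ∧
      W.stableFlow p = ⇑(W.extension p ∘ₗ W.reference.map p)) ∧
    ((∀ c : K.Chain p, ∃ j : ℕ, (W.coflow p)^[j + 1] c = (W.coflow p)^[j] c) ∧
      W.stableCoflow p = ⇑(W.coextension p ∘ₗ W.coreference.map p)) := by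
  obtain ⟨N, hN⟩ := W.exists_flow_iterate_eq p
  obtain ⟨M, hM⟩ := W.exists_coflow_iterate_eq p
  have h1 : ∀ c : K.Chain p, (W.flow p)^[N + 1] c = (W.flow p)^[N] c := fun c => by
    rw [hN _ N.le_succ, hN _ le_rfl]
  have h2 : ∀ c : K.Chain p, (W.coflow p)^[M + 1] c = (W.coflow p)^[M] c := fun c => by
    rw [hM _ M.le_succ, hM _ le_rfl]
  refine ⟨⟨fun c => ⟨N, h1 c⟩, funext fun c => ?_⟩, fun c => ⟨M, h2 c⟩, funext fun c => ?_⟩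
  -- The composite through `W.criticalChain p` agrees by definition with the one of `extensionChain`
  -- and `referenceChain`, as the inclusion is merely regrouped.
  · exact (stableValue_eq (h1 c)).trans (hN N le_rfl c)
  · exact (stableValue_eq (h2 c)).trans (hM M le_rfl c)
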